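/- **Setting.** Let $R$ be a commutative ring with $1$. A *directed acyclic multigraph* (DAMG) $G=(V,E)$ consists of a finite vertex set $V$, a finite set $E$ of (possibly parallel) directed edges with tail and head maps $E\to V$, such that there is a total order $\prec$ on $V$ in which the tail of every edge precedes its head. Write $E(x,y)$ for the set of edges from $x$ to $y$, $\mathrm{Anc}^G(x)$ and $\mathrm{Desc}^G(x)$ for the sets of ancestors and descendants of $x$ along directed paths (both contain $x$), $\mathrm{Pa}^G(y)$ for the set of parents of $y$, $\mathrm{Rt}(G)$ for the set of roots (vertices without parents) and $\mathrm{Lf}(G)$ for the set of leaves (vertices without children). An *$R$-PDAMG* $(G,q)$ is a DAMG with a map $q:E\to R$ such that, with $q(x|y):=\sum_{e\in E(x,y)}q(e)$, we have $\sum_{x\in V}q(x|y)=1$ for every $y\in V\setminus\mathrm{Rt}(G)$. For an $R$-module $A$ and a value function $v:V\to A$, the *synergy function* $v'_G:V\to A$ is defined recursively by $v'_G(x)=v(x)-\sum_{y\in\mathrm{Anc}^G(x)\setminus\{x\}}v'_G(y)$. A vertex $z$ is *weak* for $(G,v)$ if $v'_G(z)=0$; a root $r$ is a *null root* for $(G,v)$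 if $v'_G(x)=0$ for all $x\in\mathrm{Desc}^G(r)$. The *unanimity function* $\zeta_y:V\to R$ is $1$ on $\mathrm{Desc}^G(y)$ and $0$ elsewhere. $G$ is *hierarchically flat* if $V=\mathrm{Rt}(G)\cup\mathrm{Lf}(G)$. The *total path weights* $s(x|y)$ are given by $s(x|y)=0$ if $y\notin\mathrm{Desc}^G(x)$, $s(x|x)=1$, and $s(x|y)=\sum_{z\in\mathrm{Pa}^G(y)}s(x|z)\,q(z|y)$ otherwise. *Projections.* For $z\in V$ the graph $G^{\setminus z}$ has vertex set $V\setminus\{z\}$; its edges are the edges of $G$ not touching $z$ (with weight $q^{\setminus z}(e)=q(e)$), and one edge $x\xrightarrow{e_1e_2}y$, with weight $q(e_1)q(e_2)$, for every pair of edges $x\xrightarrow{e_1}z\xrightarrow{e_2}y$ of $G$. For $w:V\to A$ let $w^{\setminus z}(x)=w(x)+q(x|z)\,w(z)$. For a set $S=\{z_1,\dots,z_m\}$ of vertices, $G^{\setminus S},q^{\setminus S},w^{\setminus S}$ arise by projecting out the elements of $S$ one after the other (up to the naming of edges the result does not depend on the order), and, for $w=v'_G$, $v^{\setminus S}(y):=\sum_{x\in\mathrm{Anc}^{G^{\setminus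 S}}(y)}w^{\setminus S}(x)$. If $S\cap\mathrm{Rt}(G)=\emptyset$, then $(G^{\setminus S},q^{\setminus S})$ is again an $R$-PDAMG, with the same roots as $G$. The *Shapley values* are $$\mathrm{Sh}^{(G,q)}_r(v):=(v'_G)^{\setminus (V\setminus\mathrm{Rt}(G))}(r),\qquad r\in\mathrm{Rt}(G).$$ **Theorem.** Let $\widetilde{\mathrm{Sh}}$ be an assignment rule that assigns to every $R$-PDAMG $(G,q)$, every $R$-module $A$, every $v:V\to A$ and every $r\in\mathrm{Rt}(G)$ a value $\widetilde{\mathrm{Sh}}{}^{(G,q)}_r(v)\in A$. Then $\widetilde{\mathrm{Sh}}=\mathrm{Sh}$ if and only if $\widetilde{\mathrm{Sh}}$ has the following three properties. 1. *$A$-linearity:* for all $(G,q)$, $A$, finite $I$, $a_i\in A$, $v_i:V\to R$ ($i\in I$) and $r\in\mathrm{Rt}(G)$: $\widetilde{\mathrm{Sh}}{}^{(G,q)}_r\big(\sum_{i\in I}v_i\cdot a_i\big)=\sum_{i\in I}\widetilde{\mathrm{Sh}}{}^{(G,q)}_r(v_i)\cdot a_i$. 2. *Weak elements:* for all $(G,q)$,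 $A$, $v:V\to A$, every set $W\subseteq V\setminus\mathrm{Rt}(G)$ of weak elements for $(G,v)$ and every $r\in\mathrm{Rt}(G)$: $\widetilde{\mathrm{Sh}}{}^{(G,q)}_r(v)=\widetilde{\mathrm{Sh}}{}^{(G^{\setminus W},q^{\setminus W})}_r(v|_{V\setminus W})$. 3. *Flat hierarchy:* for every hierarchically flat $R$-PDAMG $(G,q)$, $y\in V$ and $r\in\mathrm{Rt}(G)$: $\widetilde{\mathrm{Sh}}{}^{(G,q)}_r(\zeta_y)=\delta_y(r)$ if $y\in\mathrm{Rt}(G)$, and $\widetilde{\mathrm{Sh}}{}^{(G,q)}_r(\zeta_y)=q(r|y)$ if $y\notin\mathrm{Rt}(G)$. Moreover, any $\widetilde{\mathrm{Sh}}$ with these three properties satisfies, for all $(G,q)$, $A$, $v:V\to A$ and $r\in\mathrm{Rt}(G)$: * *Efficiency:* $\sum_{r\in\mathrm{Rt}(G)}\widetilde{\mathrm{Sh}}{}^{(G,q)}_r(v)=\sum_{x\in V}v'_G(x)$. * *$R$-linearity:* $\widetilde{\mathrm{Sh}}{}^{(G,q)}_r(c_1v_1+c_2v_2)=c_1\widetilde{\mathrm{Sh}}{}^{(G,q)}_r(v_1)+c_2\widetilde{\mathrm{Sh}}{}^{(G,q)}_r(v_2)$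 for $c_1,c_2\in R$ and $v_1,v_2:V\to A$. * *Null root:* $\widetilde{\mathrm{Sh}}{}^{(G,q)}_r(v)=0$ if $r$ is a null root for $(G,v)$. * *Projection:* $\widetilde{\mathrm{Sh}}{}^{(G,q)}_r(v)=\widetilde{\mathrm{Sh}}{}^{(G^{\setminus S},q^{\setminus S})}_r(v^{\setminus S})$ for every $S\subseteq V\setminus\mathrm{Rt}(G)$. * *Total path weights:* $\widetilde{\mathrm{Sh}}{}^{(G,q)}_r(v)=\sum_{y\in V}s(r|y)\cdot v'_G(y)$, where $\sum_{r\in\mathrm{Rt}(G)}s(r|y)=1$ for all $y\in V$, and $s(r|y)=0$ whenever $y\notin\mathrm{Desc}^G(r)$. * *Symmetry:* for every automorphism $\alpha$ of $(G,q)$ (bijections of $V$ and of $E$ that are compatible with tails and heads and preserve $q$), $\widetilde{\mathrm{Sh}}{}^{(G,q)}_{\alpha(r)}(v)=\widetilde{\mathrm{Sh}}{}^{(G,q)}_r(v\circ\alpha)$; in particular, if $v'_G(\alpha(y))=v'_G(y)$ for all $y\in\mathrm{Desc}^G(r)$, then $\widetilde{\mathrm{Sh}}{}^{(G,q)}_{\alpha(r)}(v)=\widetilde{\mathrm{Sh}}{}^{(G,q)}_r(v)$.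 -/

import Mathlib

universe u w

namespace ShapleyDAMG

open scoped Classical

/-! ### Directed acyclic multigraphs -/

/-- A directed acyclic multigraph: a finite set `V` of vertices (inside an arbitrary type `U`),
a finite type `E` of edges with tail and head maps, admitting a topological ordering. -/
structure DAMG (U : Type u) where
  V : Finset U
  E : Type u
  fintypeE : Fintype E
  tail : E → V
  head : E → V
  exists_topological_ordering : ∃ o : LinearOrder V, ∀ e, o.lt (tail e) (head e)

attribute [instance] DAMG.fintypeE

noncomputable section

namespace DAMG

variable {U : Type u} (G : DAMG U)

/-- There is an edge from `x` to `y`. -/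
def Adj (x y : G.V) : Prop := ∃ e : G.E, G.tail e = x ∧ G.head e = y

/-- Parents. -/
def Pa (x : G.V) : Finset G.V := Finset.univ.filter fun y => G.Adj y x

/-- Children. -/
def Ch (x : G.V) : Finset G.V := Finset.univ.filter fun y => G.Adj x y

/-- There is a (possibly trivial) directed path from `x` to `y`. -/
def Reach (x y : G.V) : Prop := Relation.ReflTransGen G.Adj x y

/-- Ancestors, including the vertex itself. -/
def Anc (x : G.V) : Finset G.V := Finset.univ.filter fun y => G.Reach y x

/-- Descendants, including the vertex itself. -/
def Desc (x : G.V) : Finset G.V := Finset.univ.filter fun y => G.Reach x y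

/-- The set of roots. -/
def Rt : Finset U := G.V.filter fun x => ∀ h : x ∈ G.V, G.Pa ⟨x, h⟩ = ∅

/-- The set of leaves. -/
def Lf : Finset U := G.V.filter fun x => ∀ h : x ∈ G.V, G.Ch ⟨x, h⟩ = ∅

/-- `V = Rt(G) ∪ Lf(G)`. -/
def HierarchicallyFlat : Prop := G.V = G.Rt ∪ G.Lf

lemma Rt_subset : G.Rt ⊆ G.V := Finset.filter_subset _ _

/-- A root, regarded as a vertex. -/
def rootVertex (r : G.Rt) : G.V := ⟨r, G.Rt_subset r.2⟩

lemma mem_Rt_iff (x : U) : x ∈ G.Rt ↔ x ∈ G.V ∧ ∀ e : G.E, (G.head e : U) ≠ x := by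
  rw [Rt, Finset.mem_filter]
  refine and_congr_right fun hx => ⟨fun h e he => ?_, fun h hx => ?_⟩
  · have hmem : G.tail e ∈ G.Pa ⟨x, hx⟩ :=
      Finset.mem_filter.2 ⟨Finset.mem_univ _, e, rfl, Subtype.ext he⟩
    rw [h hx] at hmem
    exact Finset.notMem_empty _ hmem
  · refine Finset.filter_eq_empty_iff.2 fun y _ hy => ?_
    obtain ⟨e, -, he⟩ := hy
    exact h e (by rw [he])

lemma tail_ne_head (e : G.E) : (G.tail e : U) ≠ G.head e := by
  obtain ⟨o, ho⟩ := G.exists_topological_ordering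
  intro h
  have h1 := ho e
  rw [Subtype.ext h] at h1
  exact (@lt_irrefl _ o.toPreorder _) h1

lemma Reach.eq_of_reach {G : DAMG U} {x y : G.V} (h : G.Reach x y) (h' : G.Reach y x) :
    x = y := by
  obtain ⟨o, ho⟩ := G.exists_topological_ordering
  have key : ∀ a b : G.V, G.Reach a b → o.le a b := by
    intro a b hab
    induction hab with
    | refl => exact o.le_refl _
    | tail _ hbc ih =>
      obtain ⟨e, he1, he2⟩ := hbc
      have h1 := ho e
      rw [he1, he2] at h1
      exact o.le_trans _ _ _ ih (@le_of_lt _ o.toPreorder _ _ h1)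
  exact o.le_antisymm _ _ (key _ _ h) (key _ _ h')

lemma card_Anc_lt {x y : G.V} (h : y ∈ G.Anc x) (hne : y ≠ x) :
    (G.Anc y).card < (G.Anc x).card := by
  have hyx : G.Reach y x := (Finset.mem_filter.1 h).2
  refine Finset.card_lt_card ⟨fun z hz => ?_, fun hsub => hne ?_⟩
  · exact Finset.mem_filter.2 ⟨Finset.mem_univ _, (Finset.mem_filter.1 hz).2.trans hyx⟩
  · have hx : x ∈ G.Anc y :=
      hsub (Finset.mem_filter.2 ⟨Finset.mem_univ _, Relation.ReflTransGen.refl⟩)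
    exact hyx.eq_of_reach (Finset.mem_filter.1 hx).2

lemma mem_Anc_of_mem_Pa {x y : G.V} (h : y ∈ G.Pa x) : y ∈ G.Anc x ∧ y ≠ x := by
  obtain ⟨e, he⟩ := (Finset.mem_filter.1 h).2
  refine ⟨Finset.mem_filter.2 ⟨Finset.mem_univ _, Relation.ReflTransGen.single ⟨e, he⟩⟩, ?_⟩
  rintro rfl
  exact G.tail_ne_head e (by rw [he.1, he.2])

/-! ### Möbius transform -/

/-- The synergy function (Möbius transform) `v'_G` of a value function `v`, defined recursively by
`v'_G(x) = v(x) - ∑_{y ∈ Anc(x) \ {x}} v'_G(y)`. -/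
def synergy {A : Type w} [AddCommGroup A] (v : G.V → A) (x : G.V) : A :=
  v x - ∑ y ∈ ((G.Anc x).erase x).attach, synergy v y.1
termination_by (G.Anc x).card
decreasing_by
  exact G.card_Anc_lt (Finset.mem_of_mem_erase y.2) (Finset.ne_of_mem_erase y.2)

lemma synergy_eq {A : Type w} [AddCommGroup A] (v : G.V → A) (x : G.V) :
    G.synergy v x = v x - ∑ y ∈ (G.Anc x).erase x, G.synergy v y := by
  rw [synergy, Finset.sum_attach ((G.Anc x).erase x) (fun y => G.synergy v y)]

/-- `z` is a weak element for `(G, v)`. -/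
def IsWeak {A : Type w} [AddCommGroup A] (v : G.V → A) (z : G.V) : Prop := G.synergy v z = 0

/-- `y` is a null element for `(G, v)`. -/
def IsNull {A : Type w} [AddCommGroup A] (v : G.V → A) (y : G.V) : Prop :=
  ∀ x ∈ G.Desc y, G.synergy v x = 0

/-- The unanimity value function centred at `y`, with values in `R`. -/
def unanimity (R : Type w) [CommRing R] (y : G.V) : G.V → R :=
  fun x => if x ∈ G.Desc y then 1 else 0

/-! ### Projection of a graph onto the complement of one vertex -/

/-- The graph `G^{∖z}`: delete `z`, keep all edges not touching `z`, and add one edge `x ⟶ y` for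
every pair of edges `x ⟶ z ⟶ y`. (If `z ∉ V` then nothing but the naming of the edges changes.) -/
def proj (z : U) : DAMG U where
  V := G.V.erase z
  E := {e : G.E // (G.tail e : U) ≠ z ∧ (G.head e : U) ≠ z} ⊕
    {p : G.E × G.E // ((G.head p.1 : U) = z ∧ (G.tail p.2 : U) = z) ∧
      (G.tail p.1 : U) ≠ z ∧ (G.head p.2 : U) ≠ z}
  fintypeE := inferInstance
  tail := Sum.elim
    (fun e => ⟨G.tail e.1, Finset.mem_erase.2 ⟨e.2.1, (G.tail e.1).2⟩⟩)
    (fun p => ⟨G.tail p.1.1, Finset.mem_erase.2 ⟨p.2.2.1, (G.tail p.1.1).2⟩⟩)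
  head := Sum.elim
    (fun e => ⟨G.head e.1, Finset.mem_erase.2 ⟨e.2.2, (G.head e.1).2⟩⟩)
    (fun p => ⟨G.head p.1.2, Finset.mem_erase.2 ⟨p.2.2.2, (G.head p.1.2).2⟩⟩)
  exists_topological_ordering := by
    obtain ⟨o, ho⟩ := G.exists_topological_ordering
    let f : ↥(G.V.erase z) → G.V := fun x => ⟨x.1, Finset.mem_of_mem_erase x.2⟩
    have hf : Function.Injective f := fun a b hab => Subtype.ext (congrArg (·.1) hab)
    refine ⟨@LinearOrder.lift' _ _ o f hf, ?_⟩
    rintro (e | p)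
    · exact ho e.1
    · have h1 := ho p.1.1
      have h2 := ho p.1.2
      have h3 : G.head p.1.1 = G.tail p.1.2 := Subtype.ext (p.2.1.1.trans p.2.1.2.symm)
      rw [h3] at h1
      exact @lt_trans _ o.toPreorder _ _ _ h1 h2

/-- The inclusion `V^{∖z} ⊆ V`. -/
def incl (z : U) (x : (G.proj z).V) : G.V := ⟨x.1, Finset.mem_of_mem_erase x.2⟩

lemma mem_Rt_proj {z : U} (hz : z ∉ G.Rt) (x : U) : x ∈ (G.proj z).Rt ↔ x ∈ G.Rt := by
  rw [mem_Rt_iff, mem_Rt_iff]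
  constructor
  · rintro ⟨hx, h⟩
    obtain ⟨hxz, hxV⟩ := Finset.mem_erase.1 hx
    refine ⟨hxV, fun e he => ?_⟩
    by_cases ht : (G.tail e : U) = z
    · have hzV : z ∈ G.V := ht ▸ (G.tail e).2
      have : ∃ e1 : G.E, (G.head e1 : U) = z := by
        by_contra hcon
        push Not at hcon
        exact hz ((G.mem_Rt_iff z).2 ⟨hzV, hcon⟩)
      obtain ⟨e1, he1⟩ := this
      exact h (Sum.inr ⟨(e1, e), ⟨he1, ht⟩, he1 ▸ G.tail_ne_head e1, he ▸ hxz⟩) he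
    · exact h (Sum.inl ⟨e, ht, he ▸ hxz⟩) he
  · rintro ⟨hxV, h⟩
    refine ⟨Finset.mem_erase.2 ⟨?_, hxV⟩, ?_⟩
    · rintro rfl
      exact hz ((G.mem_Rt_iff x).2 ⟨hxV, h⟩)
    · rintro (e | p)
      · exact h e.1
      · exact h p.1.2

end DAMG

/-! ### Edge weights, total path weights, projections -/

/-- A directed acyclic multigraph together with an edge weight function `q : E → R`. -/
structure WeightedDAMG (R : Type w) (U : Type u) extends DAMG U where
  q : E → R

namespace WeightedDAMG

variable {R : Type w} [CommRing R] {U : Type u} (G : WeightedDAMG R U)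

/-- The pairwise weight `q(x|y) = ∑_{e ∈ E(x,y)} q(e)`. -/
def pairWeight (x y : G.V) : R := ∑ e : G.E with G.tail e = x ∧ G.head e = y, G.q e

/-- The total path weights `s(x|y)`. -/
def totalWeight (x y : G.V) : R :=
  if y ∉ G.Desc x then 0
  else if y = x then 1
  else ∑ z ∈ (G.Pa y).attach, totalWeight x z.1 * G.pairWeight z.1 y
termination_by (G.Anc y).card
decreasing_by
  exact G.card_Anc_lt (G.mem_Anc_of_mem_Pa z.2).1 (G.mem_Anc_of_mem_Pa z.2).2

lemma totalWeight_eq (x y : G.V) :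
    G.totalWeight x y = if y ∉ G.Desc x then 0 else if y = x then 1
      else ∑ z ∈ G.Pa y, G.totalWeight x z * G.pairWeight z y := by
  rw [totalWeight, Finset.sum_attach (G.Pa y) (fun z => G.totalWeight x z * G.pairWeight z y)]

/-- The normalization condition: `∑_{x ∈ V} q(x|y) = 1` for every non-root `y`. -/
def Normalized : Prop := ∀ y : G.V, (y : U) ∉ G.Rt → ∑ x : G.V, G.pairWeight x y = 1

/-- `(G^{∖z}, q^{∖z})`. -/
def proj (z : U) : WeightedDAMG R U where
  toDAMG := G.toDAMG.proj z
  q := Sum.elim (fun e => G.q e.1) (fun p => G.q p.1.1 * G.q p.1.2)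

/-- The projected synergy function `w^{∖z}(x) = w(x) + q(x|z) w(z)`. -/
def projSynergy {A : Type w} [AddCommGroup A] [Module R A] (z : U) (f : G.V → A) :
    (G.proj z).V → A := fun x =>
  f (G.incl z x) + if hz : z ∈ G.V then G.pairWeight (G.incl z x) ⟨z, hz⟩ • f ⟨z, hz⟩ else 0

/-- Iterated projection `(G^{∖S}, q^{∖S})`, where the list `l` enumerates the set `S`. -/
def projList (G : WeightedDAMG R U) : List U → WeightedDAMG R U
  | [] => G
  | z :: l => projList (G.proj z) l

/-- Iterated projection `w^{∖S}` of a synergy function, where the list `l` enumerates `S`. -/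
def projSynergyList {A : Type w} [AddCommGroup A] [Module R A] (G : WeightedDAMG R U) :
    (l : List U) → (G.V → A) → (G.projList l).V → A
  | [], f => f
  | z :: l, f => projSynergyList (G.proj z) l (G.projSynergy z f)

/-- The projected value function `v^{∖S}`, where the list `l` enumerates `S`. -/
def projValueList {A : Type w} [AddCommGroup A] [Module R A] (l : List U) (v : G.V → A) :
    (G.projList l).V → A := fun y =>
  ∑ x ∈ (G.projList l).Anc y, G.projSynergyList l (G.synergy v) x

lemma mem_projList_V (G : WeightedDAMG R U) (l : List U) (x : U) :
    x ∈ (G.projList l).V ↔ x ∈ G.V ∧ x ∉ l := by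
  induction l generalizing G with
  | nil => simp [projList]
  | cons z l ih =>
    rw [projList, ih]
    simp only [proj, DAMG.proj, Finset.mem_erase, List.mem_cons, not_or]
    tauto

/-- The inclusion `V^{∖S} ⊆ V`, where the list `l` enumerates `S`. -/
def inclList (l : List U) (x : (G.projList l).V) : G.V :=
  ⟨x.1, ((G.mem_projList_V l x.1).1 x.2).1⟩

lemma mem_Rt_projList (G : WeightedDAMG R U) {l : List U} (hl : ∀ z ∈ l, z ∉ G.Rt) (x : U) :
    x ∈ (G.projList l).Rt ↔ x ∈ G.Rt := by
  induction l generalizing G with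
  | nil => rfl
  | cons z l ih =>
    have hz : z ∉ G.Rt := hl z (by simp)
    have key : ∀ y, y ∈ (G.proj z).Rt ↔ y ∈ G.Rt := G.toDAMG.mem_Rt_proj hz
    rw [projList, ih (G.proj z) (fun y hy h => hl y (by simp [hy]) ((key y).1 h)), key]

lemma sum_pairWeight (y : G.V) :
    ∑ x : G.V, G.pairWeight x y = ∑ e : G.E with G.head e = y, G.q e := by
  simp only [pairWeight, Finset.sum_filter]
  rw [Finset.sum_comm]
  refine Finset.sum_congr rfl fun e _ => ?_
  by_cases h : G.head e = y <;> simp [h]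

lemma Normalized.proj {G : WeightedDAMG R U} (hG : G.Normalized) {z : U} (hz : z ∉ G.Rt) :
    (G.proj z).Normalized := by
  intro y hy
  have hy' : (y : U) ∉ G.Rt := fun h => hy ((G.toDAMG.mem_Rt_proj hz _).2 h)
  have hyz : (y : U) ≠ z := (Finset.mem_erase.1 y.2).1
  have h1 := hG (G.incl z y) hy'
  rw [sum_pairWeight, Finset.sum_filter] at h1 ⊢
  rw [← h1]
  have hE : (∑ e : (G.proj z).E, if (G.proj z).head e = y then (G.proj z).q e else 0) =
      (∑ e : {e : G.E // (G.tail e : U) ≠ z ∧ (G.head e : U) ≠ z},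
        if (G.head e.1 : U) = y then G.q e.1 else 0) +
      ∑ p : {p : G.E × G.E // ((G.head p.1 : U) = z ∧ (G.tail p.2 : U) = z) ∧
        (G.tail p.1 : U) ≠ z ∧ (G.head p.2 : U) ≠ z},
        if (G.head p.1.2 : U) = y then G.q p.1.1 * G.q p.1.2 else 0 := by
    refine (Fintype.sum_sum_type _).trans ?_
    congr 1 <;> refine Finset.sum_congr rfl fun e _ => ?_ <;>
      exact if_congr Subtype.ext_iff rfl rfl
  rw [hE]
  have hA : (∑ e : {e : G.E // (G.tail e : U) ≠ z ∧ (G.head e : U) ≠ z},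
        if (G.head e.1 : U) = y then G.q e.1 else 0) =
      ∑ e : G.E, if (G.head e : U) = y ∧ (G.tail e : U) ≠ z then G.q e else 0 := by
    rw [← Finset.sum_subtype (Finset.univ.filter fun e : G.E =>
      (G.tail e : U) ≠ z ∧ (G.head e : U) ≠ z) (by simp)
      (fun e => if (G.head e : U) = y then G.q e else 0), Finset.sum_filter]
    refine Finset.sum_congr rfl fun e _ => ?_
    by_cases h : (G.head e : U) = y <;> by_cases h' : (G.tail e : U) = z <;> simp [h, h', hyz]
  have hB : (∑ p : {p : G.E × G.E // ((G.head p.1 : U) = z ∧ (G.tail p.2 : U) = z) ∧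
        (G.tail p.1 : U) ≠ z ∧ (G.head p.2 : U) ≠ z},
        if (G.head p.1.2 : U) = y then G.q p.1.1 * G.q p.1.2 else 0) =
      ∑ e : G.E, if (G.head e : U) = y ∧ (G.tail e : U) = z then G.q e else 0 := by
    rw [← Finset.sum_subtype (Finset.univ.filter fun p : G.E × G.E =>
      ((G.head p.1 : U) = z ∧ (G.tail p.2 : U) = z) ∧
        (G.tail p.1 : U) ≠ z ∧ (G.head p.2 : U) ≠ z) (by simp)
      (fun p => if (G.head p.2 : U) = y then G.q p.1 * G.q p.2 else 0), Finset.sum_filter,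
      Fintype.sum_prod_type, Finset.sum_comm]
    refine Finset.sum_congr rfl fun e _ => ?_
    by_cases h : (G.head e : U) = y ∧ (G.tail e : U) = z
    · have hzV : z ∈ G.V := h.2 ▸ (G.tail e).2
      have h2 := hG ⟨z, hzV⟩ hz
      rw [sum_pairWeight, Finset.sum_filter] at h2
      rw [if_pos h, ← one_mul (G.q e), ← h2, Finset.sum_mul]
      refine Finset.sum_congr rfl fun e1 _ => ?_
      have hiff : G.head e1 = ⟨z, hzV⟩ ↔ (G.head e1 : U) = z := Subtype.ext_iff
      by_cases h3 : (G.head e1 : U) = z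
      · have h4 : (G.tail e1 : U) ≠ z := h3 ▸ G.tail_ne_head e1
        simp [hiff, h3, h4, h.1, h.2, hyz]
      · simp [hiff, h3]
    · rw [if_neg h]
      refine Finset.sum_eq_zero fun e1 _ => ?_
      rw [← ite_and, if_neg]
      tauto
  rw [hA, hB, ← Finset.sum_add_distrib]
  refine Finset.sum_congr rfl fun e _ => ?_
  have hiff : G.head e = G.incl z y ↔ (G.head e : U) = y := Subtype.ext_iff
  by_cases h : (G.head e : U) = y <;> by_cases h' : (G.tail e : U) = z <;> simp [hiff, h, h']

lemma Normalized.projList {G : WeightedDAMG R U} (hG : G.Normalized) {l : List U}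
    (hl : ∀ z ∈ l, z ∉ G.Rt) : (G.projList l).Normalized := by
  induction l generalizing G with
  | nil => exact hG
  | cons z l ih =>
    have hz : z ∉ G.Rt := hl z (by simp)
    have key : ∀ y, y ∈ (G.proj z).Rt ↔ y ∈ G.Rt := G.toDAMG.mem_Rt_proj hz
    exact ih (hG.proj hz) (fun y hy h => hl y (by simp [hy]) ((key y).1 h))

end WeightedDAMG

/-- A projectable directed acyclic multigraph over `R`. -/
structure PDAMG (R : Type w) [CommRing R] (U : Type u) extends WeightedDAMG R U where
  normalized : toWeightedDAMG.Normalized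

namespace PDAMG

variable {R : Type w} [CommRing R] {U : Type u}

/-- The list `l` enumerates, without repetition, a set of non-root vertices of `G`. -/
structure EnumeratesNonRoots (G : PDAMG R U) (l : List U) : Prop where
  nodup : l.Nodup
  mem_V : ∀ z ∈ l, z ∈ G.V
  notMem_Rt : ∀ z ∈ l, z ∉ G.Rt

/-- The `R`-PDAMG `(G^{∖S}, q^{∖S})` for a set `S` of non-roots enumerated by `l`. -/
def projNonRoots (G : PDAMG R U) (l : List U) (hl : G.EnumeratesNonRoots l) : PDAMG R U where
  toWeightedDAMG := G.toWeightedDAMG.projList l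
  normalized := G.normalized.projList hl.notMem_Rt

/-- A root of `G`, regarded as a root of `G^{∖S}`, for a set `S` of non-roots. -/
def projRoot (G : PDAMG R U) (l : List U) (hl : G.EnumeratesNonRoots l) (r : G.Rt) :
    (G.projNonRoots l hl).Rt :=
  ⟨r, (G.mem_Rt_projList hl.notMem_Rt r).2 r.2⟩

/-- An automorphism of an `R`-PDAMG. -/
structure Aut (G : PDAMG R U) where
  onV : Equiv.Perm G.V
  onE : Equiv.Perm G.E
  tail_onE : ∀ e, G.tail (onE e) = onV (G.tail e)
  head_onE : ∀ e, G.head (onE e) = onV (G.head e)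
  q_onE : ∀ e, G.q (onE e) = G.q e

/-- The image of a root under an automorphism, as a root. -/
def Aut.onRt {G : PDAMG R U} (α : G.Aut) (r : G.Rt) : G.Rt :=
  ⟨α.onV (G.rootVertex r), by
    rw [DAMG.mem_Rt_iff]
    refine ⟨Subtype.mem _, fun e he => ?_⟩
    obtain ⟨e', rfl⟩ := α.onE.surjective e
    rw [α.head_onE] at he
    have h := α.onV.injective (Subtype.ext he)
    exact ((G.mem_Rt_iff r).1 r.2).2 e' (by rw [h]; rfl)⟩

end PDAMG

/-! ### Assignment rules and the Shapley value -/

/-- An assignment rule: it assigns to every `R`-PDAMG `G`, every `R`-module `A`, every value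
function `v : V → A` and every root `r` of `G` a value in `A`. -/
def AssignmentRule (R : Type w) [CommRing R] : Type (max (u + 1) (w + 1)) :=
  ∀ (U : Type u) (G : PDAMG R U) (A : Type w) [AddCommGroup A] [Module R A],
    (G.V → A) → G.Rt → A

/-- The Shapley values `Sh_r(v) = (v'_G)^{Rt(G)}(r)`: the synergy function is projected onto the set
of roots, that is, all non-roots are projected out one after the other. The order in which this is
done does not matter; one order is picked by `Finset.toList`. -/
def shapley (R : Type w) [CommRing R] : AssignmentRule.{u, w} R :=
  fun _ G _ _ _ v r =>
    G.projSynergyList (G.V \ G.Rt).toList (G.synergy v)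
      ⟨r, (G.mem_projList_V _ _).2 ⟨G.Rt_subset r.2, by simp⟩⟩

namespace AssignmentRule

variable {R : Type w} [CommRing R] (Sh : AssignmentRule.{u, w} R)

/-- `Sh_r(∑ v_i · a_i) = ∑ Sh_r(v_i) · a_i` for finitely many `v_i : V → R` and `a_i ∈ A`. -/
def ALinearity : Prop :=
  ∀ (U : Type u) (G : PDAMG R U) (A : Type w) [AddCommGroup A] [Module R A]
    (I : Type) [Fintype I] (a : I → A) (v : I → G.V → R) (r : G.Rt),
    Sh U G A (fun x => ∑ i, v i x • a i) r = ∑ i, Sh U G R (v i) r • a i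

/-- For every set `W` (enumerated by `l`) of weak non-root elements,
`Sh^{(G,q)}_r(v) = Sh^{(G^{∖W},q^{∖W})}_r(v|_{V∖W})`. -/
def WeakElements : Prop :=
  ∀ (U : Type u) (G : PDAMG R U) (A : Type w) [AddCommGroup A] [Module R A] (v : G.V → A)
    (l : List U) (hl : G.EnumeratesNonRoots l),
    (∀ z (hz : z ∈ l), G.IsWeak v ⟨z, hl.mem_V z hz⟩) →
    ∀ r : G.Rt, Sh U G A v r =
      Sh U (G.projNonRoots l hl) A (fun x => v (G.inclList l x)) (G.projRoot l hl r)

/-- On hierarchically flat `R`-PDAMGs, `Sh_r(ζ_y)` is `δ_y(r)` if `y` is a root, and `q(r|y)`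
otherwise. -/
def FlatHierarchy : Prop :=
  ∀ (U : Type u) (G : PDAMG R U), G.HierarchicallyFlat → ∀ (y : G.V) (r : G.Rt),
    Sh U G R (G.unanimity R y) r =
      if (y : U) ∈ G.Rt then (if G.rootVertex r = y then 1 else 0)
      else G.pairWeight (G.rootVertex r) y

/-- `∑_{r ∈ Rt(G)} Sh_r(v) = ∑_{x ∈ V} v'_G(x)`. -/
def Efficiency : Prop :=
  ∀ (U : Type u) (G : PDAMG R U) (A : Type w) [AddCommGroup A] [Module R A] (v : G.V → A),
    ∑ r : G.Rt, Sh U G A v r = ∑ x : G.V, G.synergy v x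

/-- `Sh_r` is `R`-linear in the value function. -/
def RLinearity : Prop :=
  ∀ (U : Type u) (G : PDAMG R U) (A : Type w) [AddCommGroup A] [Module R A]
    (c₁ c₂ : R) (v₁ v₂ : G.V → A) (r : G.Rt),
    Sh U G A (fun x => c₁ • v₁ x + c₂ • v₂ x) r = c₁ • Sh U G A v₁ r + c₂ • Sh U G A v₂ r

/-- Null roots get the value `0`. -/
def NullRoot : Prop :=
  ∀ (U : Type u) (G : PDAMG R U) (A : Type w) [AddCommGroup A] [Module R A] (v : G.V → A)
    (r : G.Rt), G.IsNull v (G.rootVertex r) → Sh U G A v r = 0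

/-- For every set `S` (enumerated by `l`) of non-roots,
`Sh^{(G,q)}_r(v) = Sh^{(G^{∖S},q^{∖S})}_r(v^{∖S})`. -/
def Projection : Prop :=
  ∀ (U : Type u) (G : PDAMG R U) (A : Type w) [AddCommGroup A] [Module R A] (v : G.V → A)
    (l : List U) (hl : G.EnumeratesNonRoots l) (r : G.Rt),
    Sh U G A v r = Sh U (G.projNonRoots l hl) A (G.projValueList l v) (G.projRoot l hl r)

/-- `Sh_r(v) = ∑_y s(r|y) v'_G(y)`, where `∑_r s(r|y) = 1`, and `s(r|y) = 0` if `y` is not a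
descendant of `r`. -/
def TotalPathWeights : Prop :=
  ∀ (U : Type u) (G : PDAMG R U),
    (∀ (A : Type w) [AddCommGroup A] [Module R A] (v : G.V → A) (r : G.Rt),
      Sh U G A v r = ∑ y : G.V, G.totalWeight (G.rootVertex r) y • G.synergy v y) ∧
    (∀ y : G.V, ∑ r : G.Rt, G.totalWeight (G.rootVertex r) y = 1) ∧
    (∀ (r : G.Rt) (y : G.V), y ∉ G.Desc (G.rootVertex r) →
      G.totalWeight (G.rootVertex r) y = 0)

/-- `Sh_{α(r)}(v) = Sh_r(v ∘ α)` for every automorphism `α`; in particular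
`Sh_{α(r)}(v) = Sh_r(v)` if `v'_G(α(y)) = v'_G(y)` for all descendants `y` of `r`. -/
def Symmetry : Prop :=
  ∀ (U : Type u) (G : PDAMG R U) (A : Type w) [AddCommGroup A] [Module R A] (v : G.V → A)
    (α : G.Aut) (r : G.Rt),
    Sh U G A v (α.onRt r) = Sh U G A (fun x => v (α.onV x)) r ∧
    ((∀ y ∈ G.Desc (G.rootVertex r), G.synergy v (α.onV y) = G.synergy v y) →
      Sh U G A v (α.onRt r) = Sh U G A v r)

end AssignmentRule

end

end ShapleyDAMG

namespace ShapleyDAMG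

open scoped Classical

noncomputable section

/-! ### Ancestors and induction along them. -/

namespace DAMG

variable {U : Type u} (G : DAMG U)

/-! Everything rests on the closed formula `Sh_r(v) = ∑ s(r|y) v'(y)` (`shapley_eq_sum`). The total
path weights are the unique solution of the linear system `s = I + s·Q`, where `Q` is the matrix of
pairwise weights (`totalWeight_eq_add_sum`, `totalWeight_unique`). Projecting out `z` is Gaussian
elimination of one unknown, so `s` restricts to the smaller graph (`totalWeight_proj`) and `∑ s(x|y)
w(y)` is unchanged when `w` is projected as well (`sum_totalWeight_smul_projSynergy`). Once only
roots are left, `s` is the identity matrix and the invariant sum is the Shapley value. All listed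
properties are then statements about `s` and the Möbius transform.

For uniqueness, expand `v = ∑ ζ_y · v'(y)`; linearity leaves only `ζ_y` to be determined. Its
synergy is concentrated at `y`, so all other non-roots are weak and may be removed. What remains is
the roots and `y`, a flat graph, on which the value is prescribed (`eq_of_axioms`). -/

lemma mem_Anc {x y : G.V} : y ∈ G.Anc x ↔ G.Reach y x := by simp [Anc]

lemma mem_Desc {x y : G.V} : y ∈ G.Desc x ↔ G.Reach x y := by simp [Desc]

lemma self_mem_Anc (x : G.V) : x ∈ G.Anc x := G.mem_Anc.2 Relation.ReflTransGen.refl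

lemma Adj.mem_Anc {G : DAMG U} {x y : G.V} (h : G.Adj y x) : y ∈ G.Anc x :=
  G.mem_Anc.2 (Relation.ReflTransGen.single h)

lemma Adj.ne {G : DAMG U} {x y : G.V} (h : G.Adj y x) : y ≠ x := by
  obtain ⟨e, rfl, rfl⟩ := h
  exact fun h => G.tail_ne_head e (congrArg Subtype.val h)

/-- Induction along the order of the ancestors. -/
lemma anc_induction {P : G.V → Prop}
    (h : ∀ x, (∀ y ∈ G.Anc x, y ≠ x → P y) → P x) (x : G.V) : P x := by
  induction hn : (G.Anc x).card using Nat.strong_induction_on generalizing x with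
  | _ n ih => exact h x fun y hy hne => ih _ (hn ▸ G.card_Anc_lt hy hne) y rfl

lemma not_mem_Rt_of_adj {x y : G.V} (h : G.Adj x y) : (y : U) ∉ G.Rt := by
  obtain ⟨e, -, he⟩ := h
  exact fun hy => ((G.mem_Rt_iff y).1 hy).2 e (by rw [he])

/-! ### Möbius inversion -/

section Synergy

variable {A : Type w} [AddCommGroup A]

lemma sum_synergy (v : G.V → A) (x : G.V) : ∑ y ∈ G.Anc x, G.synergy v y = v x := by
  rw [← Finset.add_sum_erase _ _ (G.self_mem_Anc x), G.synergy_eq v x, sub_add_cancel]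

/-- Uniqueness in Möbius inversion. Synergies are computed below by guessing the answer and checking
its ancestor sums, without unfolding the recursion. -/
lemma synergy_eq_of_sum_Anc {v f : G.V → A} (h : ∀ x, ∑ y ∈ G.Anc x, f y = v x) :
    G.synergy v = f := by
  funext x
  induction x using G.anc_induction with
  | h x ih =>
    rw [G.synergy_eq, ← h x, ← Finset.add_sum_erase _ _ (G.self_mem_Anc x),
      Finset.sum_congr rfl fun y hy => ih y (Finset.mem_of_mem_erase hy) (Finset.ne_of_mem_erase hy),
      add_sub_cancel_right]

lemma synergy_unanimity (R : Type w) [CommRing R] (y : G.V) :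
    G.synergy (G.unanimity R y) = fun x => if x = y then 1 else 0 := by
  refine G.synergy_eq_of_sum_Anc fun x => ?_
  simp [unanimity, mem_Anc, mem_Desc]

lemma synergy_sum_smul {R : Type w} [CommRing R] [Module R A] {I : Type*} [Fintype I]
    (a : I → A) (v : I → G.V → R) :
    G.synergy (fun x => ∑ i, v i x • a i) = fun x => ∑ i, G.synergy (v i) x • a i := by
  refine G.synergy_eq_of_sum_Anc fun x => ?_
  rw [Finset.sum_comm]
  exact Finset.sum_congr rfl fun i _ => by rw [← Finset.sum_smul, G.sum_synergy]

lemma synergy_smul_add_smul {R : Type w} [CommRing R] [Module R A] (c₁ c₂ : R) (v₁ v₂ : G.V → A) :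
    G.synergy (fun x => c₁ • v₁ x + c₂ • v₂ x) =
      fun x => c₁ • G.synergy v₁ x + c₂ • G.synergy v₂ x := by
  refine G.synergy_eq_of_sum_Anc fun x => ?_
  rw [Finset.sum_add_distrib, ← Finset.smul_sum, ← Finset.smul_sum, G.sum_synergy, G.sum_synergy]

/-- The expansion in unanimity functions, with synergies as coordinates, to which `A`-linearity is
applied. -/
lemma sum_unanimity_smul_synergy {R : Type w} [CommRing R] [Module R A] (v : G.V → A) (x : G.V) :
    ∑ y, G.unanimity R y x • G.synergy v y = v x := by
  rw [← G.sum_synergy v x, Anc, Finset.sum_filter]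
  exact Finset.sum_congr rfl fun y _ => by simp [unanimity, mem_Desc]

end Synergy

/-! ### Projections of graphs -/

lemma incl_injective (z : U) : Function.Injective (G.incl z) := fun x y h =>
  Subtype.ext (show (G.incl z x : U) = G.incl z y by rw [h])

lemma incl_ne (z : U) (x : (G.proj z).V) : (x : U) ≠ z := Finset.ne_of_mem_erase x.2

lemma exists_incl_eq {z : U} {x : G.V} (hx : (x : U) ≠ z) : ∃ x', G.incl z x' = x :=
  ⟨⟨x, Finset.mem_erase.2 ⟨hx, x.2⟩⟩, rfl⟩

/-- Splits off the eliminated vertex. The conditional covers `z ∉ G.V`, where projecting changes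
only the names of edges. -/
lemma sum_eq_sum_incl_add {A : Type*} [AddCommMonoid A] (z : U) (f : G.V → A) :
    ∑ x, f x = ∑ x, f (G.incl z x) + if hz : z ∈ G.V then f ⟨z, hz⟩ else 0 := by
  have h : ∑ x, f (G.incl z x) = ∑ x ∈ Finset.univ.filter (fun x : G.V => (x : U) ≠ z), f x := by
    refine Finset.sum_bij (fun x _ => G.incl z x) ?_ ?_ ?_ ?_
    · exact fun x _ => Finset.mem_filter.2 ⟨Finset.mem_univ _, G.incl_ne z x⟩
    · exact fun x _ y _ h => G.incl_injective z h
    · intro x hx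
      obtain ⟨x', hx'⟩ := G.exists_incl_eq (Finset.mem_filter.1 hx).2
      exact ⟨x', Finset.mem_univ _, hx'⟩
    · exact fun _ _ => rfl
  rw [h, ← Finset.sum_filter_add_sum_filter_not Finset.univ (fun x : G.V => (x : U) ≠ z)]
  congr 1
  split_ifs with hz
  · rw [Finset.sum_eq_single (⟨z, hz⟩ : G.V)]
    · intro x hx hne
      exact absurd (Subtype.ext (by simpa using hx)) hne
    · simp
  · refine Finset.sum_eq_zero fun x hx => absurd x.2 ?_
    rwa [show (x : U) = z by simpa using hx]

lemma adj_proj {z : U} {x y : (G.proj z).V} :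
    (G.proj z).Adj x y ↔ G.Adj (G.incl z x) (G.incl z y) ∨
      ∃ c : G.V, (c : U) = z ∧ G.Adj (G.incl z x) c ∧ G.Adj c (G.incl z y) := by
  constructor
  · rintro ⟨e | p, rfl, rfl⟩
    · exact Or.inl ⟨e.1, rfl, rfl⟩
    · exact Or.inr ⟨G.head p.1.1, p.2.1.1, ⟨p.1.1, rfl, rfl⟩,
        ⟨p.1.2, Subtype.ext (p.2.1.2.trans p.2.1.1.symm), rfl⟩⟩
  · rintro (⟨e, h1, h2⟩ | ⟨c, hc, ⟨e, h1, h2⟩, ⟨e', h3, h4⟩⟩)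
    · exact ⟨Sum.inl ⟨e, h1 ▸ G.incl_ne z x, h2 ▸ G.incl_ne z y⟩,
        G.incl_injective z h1, G.incl_injective z h2⟩
    · exact ⟨Sum.inr ⟨(e, e'), ⟨h2 ▸ hc, h3 ▸ hc⟩, h1 ▸ G.incl_ne z x, h4 ▸ G.incl_ne z y⟩,
        G.incl_injective z h1, G.incl_injective z h4⟩

lemma reach_proj {z : U} {x y : (G.proj z).V} :
    (G.proj z).Reach x y ↔ G.Reach (G.incl z x) (G.incl z y) := by
  constructor
  · intro h
    induction h with
    | refl => exact Relation.ReflTransGen.refl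
    | tail _ hbc ih =>
      rcases G.adj_proj.1 hbc with h | ⟨c, -, h1, h2⟩
      · exact ih.tail h
      · exact (ih.tail h1).tail h2
  -- A path in `G` may pause at `z`, which has no counterpart in the projection. The second clause
  -- remembers the vertex from which `z` was entered, so that the step leaving `z` becomes a
  -- composite edge.
  · suffices key : ∀ b, G.Reach (G.incl z x) b →
        (∀ b', G.incl z b' = b → (G.proj z).Reach x b') ∧
        ((b : U) = z → ∃ c, (G.proj z).Reach x c ∧ G.Adj (G.incl z c) b) from
      fun h => (key _ h).1 y rfl
    intro b hb
    induction hb with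
    | refl =>
      refine ⟨fun b' hb' => ?_, fun h => absurd h (G.incl_ne z x)⟩
      rw [G.incl_injective z hb']
      exact Relation.ReflTransGen.refl
    | @tail b c _ hbc ih =>
      by_cases hbz : (b : U) = z
      · obtain ⟨d, hd, hdb⟩ := ih.2 hbz
        refine ⟨?_, fun hc => absurd (Subtype.ext (hbz.trans hc.symm)) hbc.ne⟩
        rintro c' rfl
        exact hd.tail (G.adj_proj.2 (Or.inr ⟨b, hbz, hdb, hbc⟩))
      · obtain ⟨b', rfl⟩ := G.exists_incl_eq hbz
        refine ⟨?_, fun _ => ⟨b', ih.1 b' rfl, hbc⟩⟩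
        rintro c' rfl
        exact (ih.1 b' rfl).tail (G.adj_proj.2 (Or.inl hbc))

end DAMG

/-! ### Pairwise weights after eliminating a vertex. -/

namespace WeightedDAMG

variable {R : Type w} [CommRing R] {U : Type u} (G : WeightedDAMG R U)

lemma pairWeight_eq_zero {x y : G.V} (h : ¬ G.Adj x y) : G.pairWeight x y = 0 := by
  rw [pairWeight, Finset.filter_false_of_mem, Finset.sum_empty]
  exact fun e _ he => h ⟨e, he⟩

lemma pairWeight_self (x : G.V) : G.pairWeight x x = 0 :=
  G.pairWeight_eq_zero fun h => h.ne rfl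

lemma pairWeight_proj (z : U) (x y : (G.proj z).V) :
    (G.proj z).pairWeight x y = G.pairWeight (G.incl z x) (G.incl z y) +
      if hz : z ∈ G.V then G.pairWeight (G.incl z x) ⟨z, hz⟩ * G.pairWeight ⟨z, hz⟩ (G.incl z y)
        else 0 := by
  have hx := G.incl_ne z x
  have hy := G.incl_ne z y
  have hE : (G.proj z).pairWeight x y =
      (∑ e : {e : G.E // (G.tail e : U) ≠ z ∧ (G.head e : U) ≠ z},
        if (G.tail e.1 : U) = x ∧ (G.head e.1 : U) = y then G.q e.1 else 0) +
      ∑ p : {p : G.E × G.E // ((G.head p.1 : U) = z ∧ (G.tail p.2 : U) = z) ∧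
        (G.tail p.1 : U) ≠ z ∧ (G.head p.2 : U) ≠ z},
        if (G.tail p.1.1 : U) = x ∧ (G.head p.1.2 : U) = y then G.q p.1.1 * G.q p.1.2 else 0 := by
    rw [pairWeight, Finset.sum_filter]
    refine (Fintype.sum_sum_type _).trans ?_
    congr 1 <;> refine Finset.sum_congr rfl fun e _ => ?_ <;>
      exact if_congr (and_congr Subtype.ext_iff Subtype.ext_iff) rfl rfl
  rw [hE]
  congr 1
  · rw [← Finset.sum_subtype (Finset.univ.filter fun e : G.E =>
      (G.tail e : U) ≠ z ∧ (G.head e : U) ≠ z) (by simp)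
      (fun e => if (G.tail e : U) = x ∧ (G.head e : U) = y then G.q e else 0), ← Finset.sum_filter,
      Finset.filter_filter, pairWeight]
    refine Finset.sum_congr (Finset.filter_congr fun e _ => ?_) fun _ _ => rfl
    rw [Subtype.ext_iff, Subtype.ext_iff]
    refine ⟨And.right, fun h => ⟨⟨?_, ?_⟩, h⟩⟩
    · exact h.1 ▸ hx
    · exact h.2 ▸ hy
  · rw [← Finset.sum_subtype (Finset.univ.filter fun p : G.E × G.E =>
      ((G.head p.1 : U) = z ∧ (G.tail p.2 : U) = z) ∧
        (G.tail p.1 : U) ≠ z ∧ (G.head p.2 : U) ≠ z) (by simp)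
      (fun p => if (G.tail p.1 : U) = x ∧ (G.head p.2 : U) = y then G.q p.1 * G.q p.2 else 0),
      ← Finset.sum_filter, Finset.filter_filter]
    split_ifs with hz
    -- The composite edges from `x` to `y` are indexed by `E(x,z) × E(z,y)`, so their total weight
    -- factors.
    · rw [pairWeight, pairWeight, Finset.sum_mul_sum, ← Finset.sum_product']
      refine Finset.sum_congr ?_ fun _ _ => rfl
      ext p
      simp only [Finset.mem_filter, Finset.mem_univ, true_and, Finset.mem_product,
        Subtype.ext_iff]
      constructor
      · rintro ⟨⟨⟨h1, h2⟩, -⟩, h3, h4⟩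
        exact ⟨⟨h3, h1⟩, h2, h4⟩
      · rintro ⟨⟨h3, h1⟩, h2, h4⟩
        refine ⟨⟨⟨h1, h2⟩, ?_, ?_⟩, h3, h4⟩
        · exact h3 ▸ hx
        · exact h4 ▸ hy
    · rw [Finset.filter_false_of_mem, Finset.sum_empty]
      rintro p - ⟨⟨⟨h1, -⟩, -⟩, -⟩
      exact hz (h1 ▸ (G.head p.1).2)

/-! ### Total path weights -/

lemma totalWeight_of_not_reach {x y : G.V} (h : ¬ G.Reach x y) : G.totalWeight x y = 0 := by
  rw [totalWeight_eq, if_pos (by rwa [G.mem_Desc])]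

/-- A single linear equation replaces the case distinction: if `y` is not a descendant of `x`,
neither is any parent of `y`; if `y = x`, a parent reachable from `x` would close a cycle. In both
cases the sum vanishes. -/
lemma totalWeight_eq_add_sum (x y : G.V) :
    G.totalWeight x y =
      (if y = x then 1 else 0) + ∑ z, G.totalWeight x z * G.pairWeight z y := by
  have hPa : ∑ z, G.totalWeight x z * G.pairWeight z y =
      ∑ z ∈ G.Pa y, G.totalWeight x z * G.pairWeight z y := by
    refine (Finset.sum_subset (Finset.subset_univ _) fun z _ hz => ?_).symm
    rw [G.pairWeight_eq_zero fun h => hz (Finset.mem_filter.2 ⟨Finset.mem_univ _, h⟩), mul_zero]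
  have hzero : (∀ z, G.Adj z y → ¬ G.Reach x z) →
      ∑ z, G.totalWeight x z * G.pairWeight z y = 0 := fun h => by
    refine Finset.sum_eq_zero fun z _ => ?_
    by_cases hz : G.Adj z y
    · rw [G.totalWeight_of_not_reach (h z hz), zero_mul]
    · rw [G.pairWeight_eq_zero hz, mul_zero]
  rw [totalWeight_eq]
  simp only [G.mem_Desc]
  by_cases h1 : G.Reach x y
  · rw [if_neg (not_not.2 h1)]
    split_ifs with h2
    · subst h2
      rw [hzero fun z hz h => hz.ne (DAMG.Reach.eq_of_reach (.single hz) h), add_zero]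
    · rw [hPa, zero_add]
  · rw [if_pos h1, if_neg fun h => h1 (by rw [h]; exact Relation.ReflTransGen.refl),
      hzero fun z hz h => h1 (h.tail hz), add_zero]

/-- The equation at `y` involves only proper ancestors of `y`, so acyclicity forces the solution.
Later identities for `s` follow by checking this equation. -/
lemma totalWeight_unique {x : G.V} {t : G.V → R}
    (ht : ∀ y, t y = (if y = x then 1 else 0) + ∑ z, t z * G.pairWeight z y) (y : G.V) :
    G.totalWeight x y = t y := by
  induction y using G.anc_induction with
  | h y ih =>
    rw [totalWeight_eq_add_sum, ht y]
    congr 1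
    refine Finset.sum_congr rfl fun z _ => ?_
    by_cases hz : G.Adj z y
    · rw [ih z hz.mem_Anc hz.ne]
    · rw [G.pairWeight_eq_zero hz, mul_zero, mul_zero]

lemma totalWeight_of_mem_Rt (x : G.V) {y : G.V} (hy : (y : U) ∈ G.Rt) :
    G.totalWeight x y = if y = x then 1 else 0 := by
  rw [totalWeight_eq_add_sum, add_eq_left]
  exact Finset.sum_eq_zero fun z _ => by
    rw [G.pairWeight_eq_zero fun h => G.not_mem_Rt_of_adj h hy, mul_zero]

lemma totalWeight_of_ne {x y : G.V} (h : y ≠ x) :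
    G.totalWeight x y = ∑ z, G.totalWeight x z * G.pairWeight z y := by
  rw [totalWeight_eq_add_sum, if_neg h, zero_add]

lemma totalWeight_vertex (z : U) (x : (G.proj z).V) (hz : z ∈ G.V) :
    G.totalWeight (G.incl z x) ⟨z, hz⟩ =
      ∑ y, G.totalWeight (G.incl z x) (G.incl z y) * G.pairWeight (G.incl z y) ⟨z, hz⟩ := by
  rw [G.totalWeight_of_ne fun h => G.incl_ne z x (congrArg Subtype.val h).symm,
    G.sum_eq_sum_incl_add z, dif_pos hz, pairWeight_self, mul_zero, add_zero]

/-- Substituting the equation for `s(x|z)` into the others yields the system of the projected graph,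
since its new weights are `q(x|y) + q(x|z) q(z|y)`. -/
lemma totalWeight_proj (z : U) (x y : (G.proj z).V) :
    (G.proj z).totalWeight x y = G.totalWeight (G.incl z x) (G.incl z y) := by
  refine (G.proj z).totalWeight_unique
    (t := fun y => G.totalWeight (G.incl z x) (G.incl z y)) (fun y => ?_) y
  rw [totalWeight_eq_add_sum, G.sum_eq_sum_incl_add z]
  simp only [pairWeight_proj, mul_add, Finset.sum_add_distrib]
  refine congrArg₂ (· + ·) (if_congr (G.incl_injective z).eq_iff rfl rfl)
    (congrArg₂ (· + ·) rfl ?_)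
  split_ifs with hz
  · rw [totalWeight_vertex, Finset.sum_mul]
    exact Finset.sum_congr rfl fun w _ => by ring
  · simp

variable {A : Type w} [AddCommGroup A] [Module R A]

/-- The invariant of the proof: by the equation at `z`, the lost term `s(x|z) f(z)` is `∑ s(x|y)
q(y|z) f(z)`, which is what `projSynergy` adds at the remaining vertices. -/
lemma sum_totalWeight_smul_projSynergy (z : U) (f : G.V → A) (x : (G.proj z).V) :
    ∑ y, (G.proj z).totalWeight x y • G.projSynergy z f y =
      ∑ y, G.totalWeight (G.incl z x) y • f y := by
  rw [G.sum_eq_sum_incl_add z]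
  simp only [totalWeight_proj, projSynergy, smul_add, Finset.sum_add_distrib]
  congr 1
  split_ifs with hz
  · rw [totalWeight_vertex, Finset.sum_smul]
    exact Finset.sum_congr rfl fun w _ => by rw [smul_smul]
  · simp

/-! ### Iterated projections. -/

lemma reach_projList (l : List U) (x y : (G.projList l).V) :
    (G.projList l).Reach x y ↔ G.Reach (G.inclList l x) (G.inclList l y) := by
  induction l generalizing G with
  | nil => rfl
  | cons z l ih => exact (ih (G.proj z) x y).trans G.reach_proj

lemma totalWeight_projList (l : List U) (x y : (G.projList l).V) :
    (G.projList l).totalWeight x y = G.totalWeight (G.inclList l x) (G.inclList l y) := by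
  induction l generalizing G with
  | nil => rfl
  | cons z l ih => exact (ih (G.proj z) x y).trans (G.totalWeight_proj z _ _)

lemma sum_totalWeight_smul_projSynergyList (l : List U) (f : G.V → A) (x : (G.projList l).V) :
    ∑ y, (G.projList l).totalWeight x y • G.projSynergyList l f y =
      ∑ y, G.totalWeight (G.inclList l x) y • f y := by
  induction l generalizing G with
  | nil => rfl
  | cons z l ih =>
    exact (ih (G.proj z) (G.projSynergy z f) x).trans
      (G.sum_totalWeight_smul_projSynergy z f _)

lemma inclList_injective (l : List U) : Function.Injective (G.inclList l) := fun x y h =>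
  Subtype.ext (show (G.inclList l x : U) = G.inclList l y by rw [h])

lemma exists_inclList_eq {l : List U} {x : G.V} (hx : (x : U) ∉ l) :
    ∃ x', G.inclList l x' = x :=
  ⟨⟨x, (G.mem_projList_V l x).2 ⟨x.2, hx⟩⟩, rfl⟩

lemma sum_inclList {B : Type*} [AddCommMonoid B] (l : List U) {f : G.V → B}
    (hf : ∀ x : G.V, (x : U) ∈ l → f x = 0) (s : Finset G.V) (t : Finset (G.projList l).V)
    (hst : ∀ x, x ∈ t ↔ G.inclList l x ∈ s) :
    ∑ x ∈ t, f (G.inclList l x) = ∑ x ∈ s, f x := by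
  rw [← Finset.sum_image (g := G.inclList l) (f := f) fun x _ y _ h => G.inclList_injective l h]
  refine Finset.sum_subset (fun x hx => ?_) fun x hx hx' => hf x ?_
  · obtain ⟨x', h', rfl⟩ := Finset.mem_image.1 hx
    exact (hst x').1 h'
  · by_contra hl
    obtain ⟨x', rfl⟩ := G.exists_inclList_eq hl
    exact hx' (Finset.mem_image_of_mem _ ((hst x').2 hx))

/-- Reachability between surviving vertices is unchanged, so removing weak vertices deletes only
zeros from each ancestor sum. -/
lemma synergy_projList_of_isWeak {B : Type w} [AddCommGroup B] (l : List U) {v : G.V → B}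
    (hv : ∀ x : G.V, (x : U) ∈ l → G.IsWeak v x) :
    (G.projList l).synergy (fun x => v (G.inclList l x)) =
      fun x => G.synergy v (G.inclList l x) := by
  refine (G.projList l).synergy_eq_of_sum_Anc fun x => ?_
  rw [G.sum_inclList l hv (G.Anc (G.inclList l x)), G.sum_synergy]
  intro y
  rw [DAMG.mem_Anc, DAMG.mem_Anc, reach_projList]

lemma synergy_projValueList (l : List U) (v : G.V → A) :
    (G.projList l).synergy (G.projValueList l v) = G.projSynergyList l (G.synergy v) :=
  (G.projList l).synergy_eq_of_sum_Anc fun _ => rfl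

lemma unanimity_projList (l : List U) (y : (G.projList l).V) :
    (fun x => G.unanimity R (G.inclList l y) (G.inclList l x)) =
      (G.projList l).unanimity R y := by
  funext x
  simp only [DAMG.unanimity, DAMG.mem_Desc, reach_projList]

/-- At a non-root, the total is the `q`-weighted sum of the totals at its parents; these are `1` by
induction, and the weights sum to `1`. -/
lemma Normalized.sum_totalWeight {G : WeightedDAMG R U} (hG : G.Normalized) (y : G.V) :
    ∑ r : G.Rt, G.totalWeight (G.rootVertex r) y = 1 := by
  induction y using G.anc_induction with
  | h y ih =>
    by_cases hy : (y : U) ∈ G.Rt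
    · simp only [G.totalWeight_of_mem_Rt _ hy]
      rw [Finset.sum_eq_single (⟨y, hy⟩ : G.Rt)]
      · exact if_pos rfl
      · exact fun r _ hr => if_neg fun h => hr (Subtype.ext (show (r : U) = y by rw [h]; rfl))
      · simp
    · have hne : ∀ r : G.Rt, y ≠ G.rootVertex r := fun r h => hy (h ▸ r.2)
      rw [Finset.sum_congr rfl fun r _ => G.totalWeight_of_ne (hne r), Finset.sum_comm, ← hG y hy]
      refine Finset.sum_congr rfl fun z _ => ?_
      by_cases hz : G.Adj z y
      · rw [← Finset.sum_mul, ih z hz.mem_Anc hz.ne, one_mul]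
      · simp [G.pairWeight_eq_zero hz]

/-- A parent of `y` is not a leaf, hence is a root, so the only paths from `r` to `y` are single
edges. -/
lemma totalWeight_of_hierarchicallyFlat (hG : G.HierarchicallyFlat) (r : G.Rt) {y : G.V}
    (hy : (y : U) ∉ G.Rt) :
    G.totalWeight (G.rootVertex r) y = G.pairWeight (G.rootVertex r) y := by
  rw [G.totalWeight_of_ne fun h => hy (by rw [h]; exact r.2), Finset.sum_eq_single (G.rootVertex r),
    G.totalWeight_of_mem_Rt _ r.2, if_pos rfl, one_mul]
  · intro z _ hz
    by_cases hzy : G.Adj z y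
    · have hzR : (z : U) ∈ G.Rt := by
        have hmem : (z : U) ∈ G.Rt ∪ G.Lf := hG ▸ z.2
        refine (Finset.mem_union.1 hmem).resolve_right fun hL => ?_
        have hCh := (Finset.mem_filter.1 hL).2 z.2
        exact Finset.eq_empty_iff_forall_notMem.1 hCh y
          (Finset.mem_filter.2 ⟨Finset.mem_univ _, hzy⟩)
      rw [G.totalWeight_of_mem_Rt _ hzR, if_neg hz, zero_mul]
    · rw [G.pairWeight_eq_zero hzy, mul_zero]
  · simp

end WeightedDAMG

/-! ### Reduction to flat graphs, and automorphisms. -/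

namespace PDAMG

variable {R : Type w} [CommRing R] {U : Type u} (G : PDAMG R U)

/-- All non-roots except `y`. -/
def otherNonRoots (y : G.V) : List U := ((G.V \ G.Rt).erase y).toList

lemma mem_otherNonRoots {y : G.V} {z : U} :
    z ∈ G.otherNonRoots y ↔ z ≠ y ∧ z ∈ G.V ∧ z ∉ G.Rt := by
  simp [otherNonRoots]

lemma enumeratesNonRoots_otherNonRoots (y : G.V) : G.EnumeratesNonRoots (G.otherNonRoots y) where
  nodup := Finset.nodup_toList _
  mem_V _ hz := (G.mem_otherNonRoots.1 hz).2.1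
  notMem_Rt _ hz := (G.mem_otherNonRoots.1 hz).2.2

/-- After projecting out all non-roots but one, the hierarchy is flat. -/
lemma hierarchicallyFlat_projNonRoots_otherNonRoots (y : G.V) :
    (G.projNonRoots (G.otherNonRoots y)
      (G.enumeratesNonRoots_otherNonRoots y)).HierarchicallyFlat := by
  set H := G.projNonRoots (G.otherNonRoots y) (G.enumeratesNonRoots_otherNonRoots y) with hH
  have key : ∀ x ∈ H.V, x ∉ H.Rt → x = y := by
    intro x hx hxR
    have hx' := (G.mem_projList_V _ _).1 hx
    by_contra hne
    exact hx'.2 (G.mem_otherNonRoots.2 ⟨hne, hx'.1, fun h => hxR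
      ((G.mem_Rt_projList (G.enumeratesNonRoots_otherNonRoots y).notMem_Rt x).2 h)⟩)
  refine Finset.Subset.antisymm (fun x hx => ?_)
    (Finset.union_subset H.Rt_subset (Finset.filter_subset _ _))
  by_cases hxR : x ∈ H.Rt
  · exact Finset.mem_union_left _ hxR
  refine Finset.mem_union_right _ (Finset.mem_filter.2 ⟨hx, fun hx' => ?_⟩)
  -- A child `c` of the non-root `x` would itself be a non-root, so both would equal `y`,
  -- contradicting the absence of loops.
  refine Finset.filter_eq_empty_iff.2 fun c _ hc => hc.ne (Subtype.ext ?_)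
  exact (key x hx hxR).trans (key c c.2 (H.not_mem_Rt_of_adj hc)).symm

namespace Aut

variable {G} (α : G.Aut)

lemma adj_iff {x y : G.V} : G.Adj (α.onV x) (α.onV y) ↔ G.Adj x y := by
  constructor
  · rintro ⟨e, h1, h2⟩
    obtain ⟨e, rfl⟩ := α.onE.surjective e
    rw [α.tail_onE] at h1
    rw [α.head_onE] at h2
    exact ⟨e, α.onV.injective h1, α.onV.injective h2⟩
  · rintro ⟨e, rfl, rfl⟩
    exact ⟨α.onE e, α.tail_onE e, α.head_onE e⟩

lemma reach_iff {x y : G.V} : G.Reach (α.onV x) (α.onV y) ↔ G.Reach x y := by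
  constructor
  · suffices key : ∀ b, G.Reach (α.onV x) b → G.Reach x (α.onV.symm b) from
      fun h => by simpa using key _ h
    intro b hb
    induction hb with
    | refl => rw [Equiv.symm_apply_apply]; exact Relation.ReflTransGen.refl
    | tail _ hbc ih => exact ih.tail (α.adj_iff.1 (by simpa using hbc))
  · intro h
    induction h with
    | refl => exact Relation.ReflTransGen.refl
    | tail _ hbc ih => exact ih.tail (α.adj_iff.2 hbc)

lemma pairWeight_onV (x y : G.V) : G.pairWeight (α.onV x) (α.onV y) = G.pairWeight x y := by
  rw [WeightedDAMG.pairWeight, WeightedDAMG.pairWeight, Finset.sum_filter, Finset.sum_filter,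
    ← Equiv.sum_comp α.onE]
  simp only [α.tail_onE, α.head_onE, α.q_onE, α.onV.injective.eq_iff]

/-- The relabelled weights solve the same linear system. -/
lemma totalWeight_onV (x y : G.V) : G.totalWeight (α.onV x) (α.onV y) = G.totalWeight x y := by
  refine (G.totalWeight_unique (t := fun y => G.totalWeight (α.onV x) (α.onV y)) (fun y => ?_)
    y).symm
  rw [G.totalWeight_eq_add_sum, ← Equiv.sum_comp α.onV]
  simp only [α.onV.injective.eq_iff, pairWeight_onV]

lemma synergy_comp_onV {A : Type w} [AddCommGroup A] (v : G.V → A) :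
    G.synergy (fun x => v (α.onV x)) = fun x => G.synergy v (α.onV x) := by
  refine G.synergy_eq_of_sum_Anc fun x => ?_
  rw [← G.sum_synergy v (α.onV x), DAMG.Anc, DAMG.Anc, Finset.sum_filter, Finset.sum_filter]
  refine .trans ?_ (Equiv.sum_comp α.onV _)
  exact Finset.sum_congr rfl fun y _ => if_congr α.reach_iff.symm rfl rfl

end Aut

end PDAMG

/-! ### The Shapley value -/

section Shapley

variable {R : Type w} [CommRing R] {U : Type u} (G : PDAMG R U) {A : Type w} [AddCommGroup A]
  [Module R A]

lemma shapley_eq_sum (v : G.V → A) (r : G.Rt) :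
    shapley R U G A v r = ∑ y : G.V, G.totalWeight (G.rootVertex r) y • G.synergy v y := by
  set l := (G.V \ G.Rt).toList with hl
  have hlR : ∀ z ∈ l, z ∉ G.Rt := fun z hz => by simp_all
  let r' : (G.projList l).V := ⟨r, (G.mem_projList_V _ _).2 ⟨G.Rt_subset r.2, by simp [hl]⟩⟩
  have h := G.sum_totalWeight_smul_projSynergyList l (G.synergy v) r'
  -- Every vertex left after the projection is a root, so the weights from `r'` are a unit vector
  -- and the invariant sum collapses to its term at `r'`.
  rw [Finset.sum_eq_single r', WeightedDAMG.totalWeight_of_mem_Rt, if_pos rfl, one_smul] at h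
  · exact h
  · exact (G.mem_Rt_projList hlR r).2 r.2
  · intro y _ hy
    rw [WeightedDAMG.totalWeight_of_mem_Rt, if_neg hy, zero_smul]
    rw [G.mem_Rt_projList hlR]
    have hy' := (G.mem_projList_V l y).1 y.2
    by_contra hyR
    exact hy'.2 (by simp [hl, hy'.1, hyR])
  · simp

lemma shapley_unanimity (y : G.V) (r : G.Rt) :
    shapley R U G R (G.unanimity R y) r = G.totalWeight (G.rootVertex r) y := by
  rw [shapley_eq_sum, G.synergy_unanimity]
  simp

variable (R)

lemma shapley_totalPathWeights : (shapley.{u, w} R).TotalPathWeights := fun _ G =>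
  ⟨fun _ _ _ v r => shapley_eq_sum G v r, G.normalized.sum_totalWeight,
    fun _ _ h => G.totalWeight_of_not_reach (by rwa [← G.mem_Desc])⟩

lemma shapley_aLinearity : (shapley.{u, w} R).ALinearity := by
  intro U G A _ _ I _ a v r
  simp only [shapley_eq_sum, G.synergy_sum_smul, Finset.smul_sum, Finset.sum_smul, smul_assoc]
  exact Finset.sum_comm

lemma shapley_rLinearity : (shapley.{u, w} R).RLinearity := by
  intro U G A _ _ c₁ c₂ v₁ v₂ r
  simp only [shapley_eq_sum, G.synergy_smul_add_smul, smul_add, Finset.sum_add_distrib,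
    Finset.smul_sum, smul_comm _ c₁, smul_comm _ c₂]

lemma shapley_weakElements : (shapley.{u, w} R).WeakElements := by
  intro U G A _ _ v l hl hv r
  have hv' : ∀ x : G.V, (x : U) ∈ l → G.synergy v x = 0 := fun x hx => hv x hx
  rw [shapley_eq_sum, shapley_eq_sum]
  have h := G.synergy_projList_of_isWeak l hv'
  refine .trans ?_ (Finset.sum_congr rfl fun y _ => congrArg₂ (· • ·)
    (G.totalWeight_projList l _ y).symm (congrFun h y).symm)
  exact (G.sum_inclList l (f := fun y => G.totalWeight (G.rootVertex r) y • G.synergy v y)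
    (fun x hx => by rw [hv' x hx, smul_zero]) Finset.univ Finset.univ (by simp)).symm

lemma shapley_flatHierarchy : (shapley.{u, w} R).FlatHierarchy := by
  intro U G hG y r
  rw [shapley_unanimity]
  split_ifs with hy h
  · rw [G.totalWeight_of_mem_Rt _ hy, if_pos h.symm]
  · rw [G.totalWeight_of_mem_Rt _ hy, if_neg (Ne.symm h)]
  · exact G.totalWeight_of_hierarchicallyFlat hG r hy

lemma shapley_efficiency : (shapley.{u, w} R).Efficiency := by
  intro U G A _ _ v
  simp only [shapley_eq_sum]
  rw [Finset.sum_comm]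
  refine Finset.sum_congr rfl fun y _ => ?_
  rw [← Finset.sum_smul, G.normalized.sum_totalWeight, one_smul]

lemma shapley_nullRoot : (shapley.{u, w} R).NullRoot := by
  intro U G A _ _ v r hr
  rw [shapley_eq_sum]
  refine Finset.sum_eq_zero fun y _ => ?_
  by_cases hy : y ∈ G.Desc (G.rootVertex r)
  · rw [hr y hy, smul_zero]
  · rw [G.totalWeight_of_not_reach (by rwa [← G.mem_Desc]), zero_smul]

lemma shapley_projection : (shapley.{u, w} R).Projection := by
  intro U G A _ _ v l hl r
  refine (shapley_eq_sum G v r).trans (.trans ?_ (shapley_eq_sum (G.projNonRoots l hl) _ _).symm)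
  refine .trans ?_ (Finset.sum_congr rfl fun y _ => congrArg₂ (· • ·) rfl
    (congrFun (G.synergy_projValueList l v) y).symm)
  exact (G.sum_totalWeight_smul_projSynergyList l (G.synergy v)
    ((G.projNonRoots l hl).rootVertex (G.projRoot l hl r))).symm

lemma shapley_symmetry : (shapley.{u, w} R).Symmetry := by
  intro U G A _ _ v α r
  -- Both claims compare with this sum: the first identifies its synergy factor with that of `v ∘
  -- α`, the second needs equality only on descendants of `r`, as the weight vanishes elsewhere.
  have h : shapley R U G A v (α.onRt r) =
      ∑ y, G.totalWeight (G.rootVertex r) y • G.synergy v (α.onV y) := by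
    rw [shapley_eq_sum, ← Equiv.sum_comp α.onV]
    exact Finset.sum_congr rfl fun y _ =>
      congrArg (· • _) (α.totalWeight_onV (G.rootVertex r) y)
  refine ⟨?_, fun hv => ?_⟩
  · rw [h, shapley_eq_sum, α.synergy_comp_onV]
  · rw [h, shapley_eq_sum]
    refine Finset.sum_congr rfl fun y _ => ?_
    by_cases hy : y ∈ G.Desc (G.rootVertex r)
    · rw [hv y hy]
    · rw [G.totalWeight_of_not_reach (by rwa [← G.mem_Desc]), zero_smul, zero_smul]

end Shapley

/-! ### Uniqueness from the three axioms. -/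

namespace AssignmentRule

variable {R : Type w} [CommRing R] {Sh Sh' : AssignmentRule.{u, w} R}

lemma ALinearity.eq_sum (hA : Sh.ALinearity) {U : Type u} (G : PDAMG R U) {A : Type w}
    [AddCommGroup A] [Module R A] (v : G.V → A) (r : G.Rt) :
    Sh U G A v r = ∑ y, Sh U G R (G.unanimity R y) r • G.synergy v y := by
  -- `ALinearity` takes index types in `Type`, whereas `G.V` lives in universe `u`; the vertices are
  -- therefore enumerated by `Fin`.
  let e : G.V ≃ Fin (Fintype.card G.V) := Fintype.equivFin _
  have h := hA U G A (Fin (Fintype.card G.V)) (fun i => G.synergy v (e.symm i))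
    (fun i => G.unanimity R (e.symm i)) r
  rw [e.symm.sum_comp (fun y => Sh U G R (G.unanimity R y) r • G.synergy v y)] at h
  rw [← h]
  congr 1
  funext x
  rw [e.symm.sum_comp (fun y => G.unanimity R y x • G.synergy v y),
    G.sum_unanimity_smul_synergy]

/-- The synergy of `ζ_y` vanishes off `y`, so all other non-roots can go; since reachability
survives, the restriction is again a unanimity function. The right side lives on a flat graph. -/
lemma WeakElements.unanimity_eq (hW : Sh.WeakElements) {U : Type u} (G : PDAMG R U) (y : G.V)
    (r : G.Rt) :
    Sh U G R (G.unanimity R y) r =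
      Sh U (G.projNonRoots _ (G.enumeratesNonRoots_otherNonRoots y)) R
        ((G.projNonRoots _ (G.enumeratesNonRoots_otherNonRoots y)).unanimity R
          ⟨y, (G.mem_projList_V _ _).2 ⟨y.2, fun h => (G.mem_otherNonRoots.1 h).1 rfl⟩⟩)
        (G.projRoot _ (G.enumeratesNonRoots_otherNonRoots y) r) := by
  rw [hW U G R (G.unanimity R y) _ (G.enumeratesNonRoots_otherNonRoots y)]
  · exact congrArg (fun v => Sh U _ R v _) (G.unanimity_projList (R := R) (G.otherNonRoots y)
      ⟨y, (G.mem_projList_V _ _).2 ⟨y.2, fun h => (G.mem_otherNonRoots.1 h).1 rfl⟩⟩)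
  · intro z hz
    rw [DAMG.IsWeak, G.synergy_unanimity]
    exact if_neg fun h => (G.mem_otherNonRoots.1 hz).1 (congrArg Subtype.val h)

/-- An assignment rule is determined by `A`-linearity, its invariance under the removal of weak
elements, and its values on flat hierarchies. -/
lemma eq_of_axioms (hA : Sh.ALinearity) (hW : Sh.WeakElements) (hF : Sh.FlatHierarchy)
    (hA' : Sh'.ALinearity) (hW' : Sh'.WeakElements) (hF' : Sh'.FlatHierarchy) : Sh = Sh' := by
  funext U G A _ _ v r
  rw [hA.eq_sum, hA'.eq_sum]
  refine Finset.sum_congr rfl fun y _ => ?_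
  have hflat := G.hierarchicallyFlat_projNonRoots_otherNonRoots y
  rw [hW.unanimity_eq, hW'.unanimity_eq, hF _ _ hflat, hF' _ _ hflat]

end AssignmentRule

end

end ShapleyDAMG

theorem mainTheorem6 (R : Type w) [CommRing R] :
    (∀ Sh : ShapleyDAMG.AssignmentRule.{u, w} R,
      (Sh.ALinearity ∧ Sh.WeakElements ∧ Sh.FlatHierarchy) ↔ Sh = ShapleyDAMG.shapley.{u, w} R) ∧
    (∀ Sh : ShapleyDAMG.AssignmentRule.{u, w} R,
      (Sh.ALinearity ∧ Sh.WeakElements ∧ Sh.FlatHierarchy) →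
        Sh.Efficiency ∧ Sh.RLinearity ∧ Sh.ALinearity ∧ Sh.NullRoot ∧ Sh.Projection ∧
        Sh.WeakElements ∧ Sh.TotalPathWeights ∧ Sh.Symmetry) := by
  have key : ∀ Sh : ShapleyDAMG.AssignmentRule.{u, w} R,
      (Sh.ALinearity ∧ Sh.WeakElements ∧ Sh.FlatHierarchy) ↔
        Sh = ShapleyDAMG.shapley.{u, w} R := by
    refine fun Sh => ⟨fun ⟨hA, hW, hF⟩ => ?_, ?_⟩
    · exact ShapleyDAMG.AssignmentRule.eq_of_axioms hA hW hF (ShapleyDAMG.shapley_aLinearity R)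
        (ShapleyDAMG.shapley_weakElements R) (ShapleyDAMG.shapley_flatHierarchy R)
    · rintro rfl
      exact ⟨ShapleyDAMG.shapley_aLinearity R, ShapleyDAMG.shapley_weakElements R,
        ShapleyDAMG.shapley_flatHierarchy R⟩
  refine ⟨key, fun Sh h => ?_⟩
  obtain rfl := (key Sh).1 h
  exact ⟨ShapleyDAMG.shapley_efficiency R, ShapleyDAMG.shapley_rLinearity R,
    ShapleyDAMG.shapley_aLinearity R, ShapleyDAMG.shapley_nullRoot R,
    ShapleyDAMG.shapley_projection R, ShapleyDAMG.shapley_weakElements R,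
    ShapleyDAMG.shapley_totalPathWeights R, ShapleyDAMG.shapley_symmetry R⟩
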